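/- Let $T$ be a (one-sorted) first-order theory, in a language of arbitrary cardinality. For $n \in \omega$ and a cardinal $\kappa$, a \emph{cdt-pattern of depth $\kappa$ in $n$ free variables} (modulo $T$) consists of formulas $\varphi_i(x;y_i)$ with $|x| = n$ and numbers $n_i < \omega$, for successor ordinals $i < \kappa$, and a tree of finite tuples $(a_\eta)_{\eta \in \omega^{<\kappa}}$ in a model of $T$ such that (a) for every $\eta \in \omega^{\kappa}$, the set $\{\varphi_i(x; a_{\eta|i}) : i < \kappa,\ i \text{ successor}\}$ is consistent (finitely satisfiable in the model), and (b) for every $\eta \in \omega^{<\kappa}$ such that $i = l(\eta)+1 < \kappa$, the family $(\varphi_i(x; a_{\eta \frown \langle \alpha \rangle}))_{\alpha < \omega}$ is $n_i$-inconsistent, i.e. no $n_i$ of its members (with distinct indices $\alpha$) are simultaneously satisfied. Let $\kappa^n_{\mathrm{cdt}}(T)$ be the first cardinal $\kappa$ such that there is no cdt-pattern of depth $\kappa$ in $n$ free variables, and $\infty$ if no such $\kappa$ exists (where $\infty$ is larger than all cardinals). Then for every $n \geq 1$ such that at least one of $\kappa^1_{\mathrm{cdt}}(T)$ and $\kappa^n_{\mathrm{cdt}}(T)$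 is infinite (an infinite cardinal or $\infty$), $$\kappa^1_{\mathrm{cdt}}(T) = \kappa^n_{\mathrm{cdt}}(T).$$ -/

import Mathlib

open FirstOrder Cardinal Set

universe u v w z

namespace CdtPattern

/-- The node `η ⌢ ⟨α⟩` of height `j + 1`, for a node `η` of height `j`. Here and below, a node of
height `i` in the tree `ω^{<κ}` is a function from the ordinals below `i` to `ℕ`. -/
noncomputable def snoc {j : Ordinal.{w}} (η : Iio j → ℕ) (α : ℕ) : Iio (Order.succ j) → ℕ :=
  open Classical in
  fun x => if h : x.1 < j then η ⟨x.1, h⟩ else α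

/-- The restriction `η | i` of a node or branch `η ∈ ω^o` to `i ≤ o`. -/
def nodeBelow {o i : Ordinal.{w}} (η : Iio o → ℕ) (h : i ≤ o) : Iio i → ℕ :=
  fun x => η ⟨x.1, lt_of_lt_of_le x.2 h⟩

/-- The solution set in `M` of the instance `φ(x; b)` of the formula `φ(x; y)`. -/
def solutions {L : FirstOrder.Language.{u, v}} {M : Type z} [L.Structure M] {n m : ℕ}
    (φ : L.Formula (Fin n ⊕ Fin m)) (b : Fin m → M) : Set (Fin n → M) :=
  {x | φ.Realize (Sum.elim x b)}

/-- A family of formulas with parameters in `M`, given by their solution sets, is consistent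
(is a partial type over `M`) if all its finite subfamilies are satisfied in `M`. -/
def Consistent {X : Type z} {ι : Type w} (S : ι → Set X) : Prop :=
  ∀ s : Finset ι, ∃ x, ∀ i ∈ s, x ∈ S i

/-- A family of formulas with parameters in `M`, given by their solution sets, is
`k`-inconsistent if no `k` of its members are satisfied together. -/
def KInconsistent {X : Type z} {ι : Type w} (k : ℕ) (S : ι → Set X) : Prop :=
  ∀ s : Finset ι, s.card = k → ¬ ∃ x, ∀ i ∈ s, x ∈ S i

end CdtPattern

open CdtPattern in
/-- A cdt-pattern of depth `κ` in `n` free variables, with parameters in the structure `M`.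
The data are only used at successor ordinals `i < κ` (where `κ` is identified with its initial
ordinal `κ.ord`). -/
structure CdtPattern (L : FirstOrder.Language.{u, v}) (M : Type z) [L.Structure M]
    (n : ℕ) (κ : Cardinal.{w}) where
  /-- the length of the tuple of variables `y_i` -/
  arity : Ordinal.{w} → ℕ
  /-- the formulas `φ_i(x; y_i)` -/
  formula : (i : Ordinal.{w}) → L.Formula (Fin n ⊕ Fin (arity i))
  /-- the numbers `n_i` -/
  bound : Ordinal.{w} → ℕ
  /-- the tree of tuples `a_η`, where `η` has height `i` -/
  param : (i : Ordinal.{w}) → (Iio i → ℕ) → (Fin (arity i) → M)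
  /-- every branch is consistent -/
  consistent : ∀ η : Iio κ.ord → ℕ,
    Consistent (fun i : {i : Ordinal.{w} // i < κ.ord ∧ i ∈ range Order.succ} =>
      solutions (formula i.1) (param i.1 (nodeBelow η i.2.1.le)))
  /-- the immediate successors of a node of height `j` are `n_{j+1}`-inconsistent -/
  inconsistent : ∀ j : Ordinal.{w}, Order.succ j < κ.ord → ∀ η : Iio j → ℕ,
    KInconsistent (bound (Order.succ j)) (fun α : ℕ =>
      solutions (formula (Order.succ j)) (param (Order.succ j) (snoc η α)))

/-- There is a cdt-pattern of depth `κ` in `n` free variables modulo `T`, i.e. one with parameters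
in some model of `T`. -/
def HasCdtPattern {L : FirstOrder.Language.{u, v}} (T : L.Theory) (n : ℕ)
    (κ : Cardinal.{max u v}) : Prop :=
  ∃ M : FirstOrder.Language.Theory.ModelType.{u, v, max u v} T, Nonempty (CdtPattern L M n κ)

/-- `κ^n_cdt(T)`: the first cardinal `κ` such that there is no cdt-pattern of depth `κ` in `n` free
variables, and `∞ = ⊤` if there is no such cardinal. -/
noncomputable def kappaCdt {L : FirstOrder.Language.{u, v}} (T : L.Theory) (n : ℕ) :
    WithTop Cardinal.{max u v} :=
  sInf ((fun κ : Cardinal.{max u v} => (κ : WithTop Cardinal.{max u v})) ''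
    {κ | ¬ HasCdtPattern T n κ})

/-! Patterns are translated into dividing. Consider sets `A i ⊆ B i ⊆ A j` (`i < j`) and a finite
tuple `c` such that `tp(c / B i)` divides over `A i` at every level `i`. Up to ultrapowers, such
chains and cdt-patterns yield each other (`exists_isDividingChain`,
`IsDividingChain.exists_cdtPattern`).

Dividing splits along tuples: if `tp(c₁c₂ / B)` divides over `A`, then `tp(c₁ / B)` divides over `A`
or `tp(c₂ / Bc₁)` divides over `Ac₁` (`TypeDivides.fst_or_snd`). Iterating this colours the levels
of a chain for an `n`-tuple with `n` colours, each class carrying a chain for one element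
(`IsDividingChain.exists_coloring`). By pigeonhole an infinite depth survives in some class. A
finite depth shrinks by a factor of about `n`, which is harmless once patterns of all finite depths
exist; the infinity assumption provides them. The other inequality comes from dummy variables.

No saturation is available, so dividing is phrased with arbitrarily long finite sequences inside
definable sets, and ultrapowers play the role of compactness. -/

namespace CdtPattern

/-! ### Definable sets and their parameters. -/

section Definability

variable {L : FirstOrder.Language.{u, v}} {M : Type z} [L.Structure M] {A : Set M}

theorem definable_iff_exists_fin_params {ρ : Type*} {D : Set (ρ → M)} :
    A.Definable L D ↔ ∃ (p : ℕ) (θ : L.Formula (Fin p ⊕ ρ)) (a : Fin p → M),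
      range a ⊆ A ∧ D = {v | θ.Realize (Sum.elim a v)} := by
  constructor
  · intro h
    obtain ⟨A₀, hA₀, h⟩ := definable_iff_finitely_definable.1 h
    obtain ⟨φ, rfl⟩ := definable_iff_exists_formula_sum.1 h
    refine ⟨A₀.card, φ.relabel (Sum.map A₀.equivFin id), fun i => (A₀.equivFin.symm i : M), ?_, ?_⟩
    · rintro _ ⟨i, rfl⟩
      exact hA₀ (A₀.equivFin.symm i).2
    · ext v
      simp only [mem_ofPred_eq, Language.Formula.realize_relabel]
      apply iff_of_eq
      congr 1
      funext x
      rcases x with x | x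
      · simp only [Function.comp_apply, Sum.map_inl, Sum.elim_inl]
        exact congrArg Subtype.val (A₀.equivFin.symm_apply_apply x).symm
      · rfl
  · rintro ⟨p, θ, a, ha, rfl⟩
    refine definable_iff_exists_formula_sum.2
      ⟨θ.relabel (Sum.map (fun i => (⟨a i, ha (mem_range_self i)⟩ : A)) id), ?_⟩
    ext v
    simp only [mem_ofPred_eq, Language.Formula.realize_relabel]
    apply iff_of_eq
    congr 1
    funext x
    rcases x with x | x <;> rfl

theorem definable_range_iff {γ ρ : Type*} (p : γ → M) {D : Set (ρ → M)} :
    (range p).Definable L D ↔ ∃ ψ : L.Formula (γ ⊕ ρ), D = {v | ψ.Realize (Sum.elim p v)} := by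
  rw [definable_iff_exists_formula_sum]
  constructor
  · rintro ⟨φ, rfl⟩
    choose g hg using fun a : range p => a.2
    refine ⟨φ.relabel (Sum.map g id), ?_⟩
    ext v
    simp only [mem_ofPred_eq, Language.Formula.realize_relabel]
    apply iff_of_eq
    congr 1
    funext x
    rcases x with x | x
    · simp [hg]
    · rfl
  · rintro ⟨ψ, rfl⟩
    refine ⟨ψ.relabel (Sum.map (fun i => (⟨p i, mem_range_self i⟩ : range p)) id), ?_⟩
    ext v
    simp only [mem_ofPred_eq, Language.Formula.realize_relabel]
    apply iff_of_eq
    congr 1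
    funext x
    rcases x with x | x <;> rfl

/-- Fibers of definable sets over parameter tuples are definable. -/
theorem definable_fiber {σ ρ : Type*} (c : σ → M) (hc : range c ⊆ A) {D : Set (σ ⊕ ρ → M)}
    (hD : A.Definable L D) : A.Definable L {v : ρ → M | Sum.elim c v ∈ D} := by
  obtain ⟨φ, rfl⟩ := definable_iff_exists_formula_sum.1 hD
  refine definable_iff_exists_formula_sum.2 ⟨φ.relabel (Sum.elim Sum.inl
    (Sum.map (fun i => (⟨c i, hc (mem_range_self i)⟩ : A)) id)), ?_⟩
  ext v
  simp only [mem_ofPred_eq, Language.Formula.realize_relabel]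
  apply iff_of_eq
  congr 1
  funext x
  rcases x with x | x | x <;> rfl

/-- A set definable over `A` and `c` is the fiber over `c` of a set definable over `A`. -/
theorem exists_definable_fiber {σ ρ : Type*} (c : σ → M) {D : Set (ρ → M)}
    (hD : (A ∪ range c).Definable L D) :
    ∃ D' : Set (σ ⊕ ρ → M), A.Definable L D' ∧ D = {v | Sum.elim c v ∈ D'} := by
  classical
  have : range (Sum.elim (Subtype.val : A → M) c) = A ∪ range c := by
    rw [Sum.elim_range, Subtype.range_val]
  rw [← this] at hD
  obtain ⟨ψ, rfl⟩ := (definable_range_iff _).1 hD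
  refine ⟨_, definable_iff_exists_formula_sum.2 ⟨ψ.relabel (Equiv.sumAssoc _ _ _), rfl⟩, ?_⟩
  ext v
  simp only [mem_ofPred_eq, Language.Formula.realize_relabel]
  apply iff_of_eq
  congr 1
  funext x
  rcases x with (x | x) | x <;> rfl

theorem definable_kInconsistent {σ ξ : Type*} [Finite ξ] {N : ℕ} (k : ℕ)
    {G : Fin N → Set (σ ⊕ ξ → M)} (hG : ∀ t, A.Definable L (G t)) :
    A.Definable L {w : σ → M | KInconsistent k (fun t => {x : ξ → M | Sum.elim w x ∈ G t})} := by
  have h := definable_biInter_finset (fun s : Finset (Fin N) =>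
    (definable_biInter_finset hG s).exists_of_finite.compl) (Finset.univ.powersetCard k)
  convert h using 1
  ext w
  simp [KInconsistent]

end Definability

theorem KInconsistent.comp {X : Type z} {ι κ : Type*} {k : ℕ} {S : ι → Set X}
    (h : KInconsistent k S) (g : κ ↪ ι) : KInconsistent k (fun t => S (g t)) := by
  intro s hs
  rintro ⟨x, hx⟩
  refine h (s.map g) (by rw [Finset.card_map, hs]) ⟨x, fun i hi => ?_⟩
  obtain ⟨t, ht, rfl⟩ := Finset.mem_map.1 hi
  exact hx t ht

theorem KInconsistent.preimage {X Y : Type z} {ι : Type*} {k : ℕ} {S : ι → Set X}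
    (h : KInconsistent k S) (F : Y → X) : KInconsistent k (fun t => F ⁻¹' S t) := by
  intro s hs
  rintro ⟨x, hx⟩
  exact h s hs ⟨F x, hx⟩

/-! ### Dividing and its behaviour on tuples. -/

section Dividing

variable (L : FirstOrder.Language.{u, v}) {M : Type z} [L.Structure M]

/-- The set `E(x; b)` divides over `A`: every `A`-definable set containing `b` contains
arbitrarily long tuples of parameters for which the instances of `E` are `k`-inconsistent. -/
def Divides (A : Set M) {ξ β : Type} (E : Set (ξ ⊕ β → M)) (b : β → M) (k : ℕ) : Prop :=
  ∀ D : Set (β → M), A.Definable L D → b ∈ D → ∀ N : ℕ, ∃ f : Fin N → β → M,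
    (∀ t, f t ∈ D) ∧ KInconsistent k (fun t => {x : ξ → M | Sum.elim x (f t) ∈ E})

/-- The type of `c` over `B` contains a formula that divides over `A`. -/
def TypeDivides {ξ : Type} (c : ξ → M) (B A : Set M) : Prop :=
  ∃ (m : ℕ) (φ : L.Formula (ξ ⊕ Fin m)) (b : Fin m → M) (k : ℕ), range b ⊆ B ∧
    φ.Realize (Sum.elim c b) ∧ Divides L A {v | φ.Realize v} b k

variable {L}

/-- The parameters of `E` from `A` are appended to `b` and kept constant along the witnessing
sequences; this lets definable sets replace parameter-free formulas. -/
theorem typeDivides_of_definable {ξ : Type} {c : ξ → M} {B A : Set M} (hAB : A ⊆ B) {m : ℕ}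
    {E : Set (ξ ⊕ Fin m → M)} (hE : A.Definable L E) {b : Fin m → M} (hb : range b ⊆ B)
    (hc : Sum.elim c b ∈ E) {k : ℕ} (h : Divides L A E b k) : TypeDivides L c B A := by
  obtain ⟨p, θ, a, ha, rfl⟩ := definable_iff_exists_fin_params.1 hE
  have key : ∀ (x : ξ → M) (y : Fin m → M),
      (θ.relabel (Sum.elim (fun i => Sum.inr (Fin.natAdd m i))
        (Sum.map id (Fin.castAdd p))) : L.Formula (ξ ⊕ Fin (m + p))).Realize
          (Sum.elim x (Fin.append y a)) ↔ θ.Realize (Sum.elim a (Sum.elim x y)) := by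
    intro x y
    rw [Language.Formula.realize_relabel]
    apply iff_of_eq
    congr 1
    funext i
    rcases i with i | i | i <;> simp
  refine ⟨m + p, _, Fin.append b a, k, ?_, (key c b).2 hc, ?_⟩
  · rintro _ ⟨i, rfl⟩
    refine Fin.addCases (fun i => ?_) (fun i => ?_) i
    · simpa using hb (mem_range_self i)
    · simpa using hAB (ha (mem_range_self i))
  · intro D hD hbD N
    have hD' : A.Definable L {y : Fin m → M | Fin.append y a ∈ D} := by
      convert definable_fiber a ha
        (hD.preimage_comp (Fin.addCases (fun i => Sum.inr i) (fun i => Sum.inl i) :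
          Fin (m + p) → Fin p ⊕ Fin m)) using 1
      ext y
      simp only [mem_ofPred_eq, mem_preimage]
      apply iff_of_eq
      congr 1
      funext i
      refine Fin.addCases (fun i => ?_) (fun i => ?_) i <;> simp
    obtain ⟨f, hf, hk⟩ := h _ hD' hbD N
    refine ⟨fun t => Fin.append (f t) a, hf, ?_⟩
    simpa only [mem_ofPred_eq, key] using hk

/-- If the type of `(c₁, c₂)` over `B` divides over `A`, then so does the type of `c₁` over `B`,
or the type of `c₂` over `B c₁` divides over `A c₁`. -/
theorem TypeDivides.fst_or_snd {ξ₁ ξ₂ : Type} [Finite ξ₁] [Finite ξ₂] {c₁ : ξ₁ → M} {c₂ : ξ₂ → M}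
    {B A : Set M} (hAB : A ⊆ B) (h : TypeDivides L (Sum.elim c₁ c₂) B A) :
    TypeDivides L c₁ B A ∨ TypeDivides L c₂ (B ∪ range c₁) (A ∪ range c₁) := by
  obtain ⟨m, φ, b, k, hb, hφ, hdiv⟩ := h
  set E : Set ((ξ₁ ⊕ ξ₂) ⊕ Fin m → M) := {v | φ.Realize v} with hE
  have hEdef : A.Definable L E := (empty_definable_iff.2 ⟨φ, rfl⟩).mono (empty_subset A)
  have hE₂ : (A ∪ range c₁).Definable L
      {v : ξ₂ ⊕ Fin m → M | Sum.elim c₁ v ∈ (fun g : ξ₁ ⊕ (ξ₂ ⊕ Fin m) → M =>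
        g ∘ (Equiv.sumAssoc ξ₁ ξ₂ (Fin m))) ⁻¹' E} :=
    definable_fiber c₁ subset_union_right
      ((hEdef.mono subset_union_left).preimage_comp (Equiv.sumAssoc ξ₁ ξ₂ (Fin m)))
  have hassoc : ∀ (x₁ : ξ₁ → M) (x₂ : ξ₂ → M) (y : Fin m → M),
      Sum.elim x₁ (Sum.elim x₂ y) ∘ (Equiv.sumAssoc ξ₁ ξ₂ (Fin m)) =
        Sum.elim (Sum.elim x₁ x₂) y := by
    intro x₁ x₂ y
    funext i
    rcases i with (i | i) | i <;> rfl
  by_cases hsnd : Divides L (A ∪ range c₁) {v : ξ₂ ⊕ Fin m → M | Sum.elim c₁ v ∈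
      (fun g : ξ₁ ⊕ (ξ₂ ⊕ Fin m) → M => g ∘ (Equiv.sumAssoc ξ₁ ξ₂ (Fin m))) ⁻¹' E} b k
  · refine Or.inr (typeDivides_of_definable (union_subset_union_left _ hAB) hE₂
      (hb.trans subset_union_left) ?_ hsnd)
    simpa only [mem_ofPred_eq, mem_preimage, hassoc, hE] using hφ
  · left
    simp only [Divides, mem_ofPred_eq, mem_preimage, hassoc] at hsnd
    push Not at hsnd
    obtain ⟨D, hD, hbD, N, hN⟩ := hsnd
    obtain ⟨D', hD', rfl⟩ := exists_definable_fiber c₁ hD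
    -- `D'` and `N` witness that `E(c₁, x₂; b)` does not divide over `A c₁`. `F(x₁, f)` says that
    -- `f` is a sequence of length `N` in `D'(x₁, ·)` whose instances `E(x₁, x₂; f t)` are
    -- `k`-inconsistent in `x₂`; no such `f` exists for `c₁`.
    let F : Set (ξ₁ ⊕ Fin N × Fin m → M) := {w | (∀ t, w ∘ Sum.map id (Prod.mk t) ∈ D') ∧
      KInconsistent k (fun t => {x : ξ₂ → M | Sum.elim w x ∈
        (fun g : (ξ₁ ⊕ Fin N × Fin m) ⊕ ξ₂ → M => g ∘ Sum.elim (Sum.map Sum.inl id)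
          (fun i => Sum.inl (Sum.inr (t, i)))) ⁻¹' E})}
    have hF : A.Definable L F := by
      have h₁ := definable_iInter_of_finite (fun t : Fin N =>
        hD'.preimage_comp (Sum.map (id : ξ₁ → ξ₁) (Prod.mk t : Fin m → Fin N × Fin m)))
      have h₂ := definable_kInconsistent (σ := ξ₁ ⊕ Fin N × Fin m) k (fun t : Fin N =>
        hEdef.preimage_comp (Sum.elim (Sum.map Sum.inl id)
          (fun i => Sum.inl (Sum.inr (t, i))) :
            (ξ₁ ⊕ ξ₂) ⊕ Fin m → (ξ₁ ⊕ Fin N × Fin m) ⊕ ξ₂))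
      convert h₁.inter h₂ using 1
      ext w
      simp [F]
    have hFmem : ∀ (x₁ : ξ₁ → M) (f : Fin N → Fin m → M),
        Sum.elim x₁ (fun i : Fin N × Fin m => f i.1 i.2) ∈ F ↔
          (∀ t, Sum.elim x₁ (f t) ∈ D') ∧
            KInconsistent k (fun t => {x : ξ₂ → M | Sum.elim (Sum.elim x₁ x) (f t) ∈ E}) := by
      intro x₁ f
      have e₁ : ∀ t, Sum.elim x₁ (fun i : Fin N × Fin m => f i.1 i.2) ∘ Sum.map id (Prod.mk t) =
          Sum.elim x₁ (f t) := fun t => by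
        funext i
        rcases i with i | i <;> rfl
      have e₂ : ∀ t (x : ξ₂ → M), Sum.elim (Sum.elim x₁ (fun i : Fin N × Fin m => f i.1 i.2)) x ∘
          Sum.elim (Sum.map Sum.inl id) (fun i => Sum.inl (Sum.inr (t, i))) =
            Sum.elim (Sum.elim x₁ x) (f t) := fun t x => by
        funext i
        rcases i with (i | i) | i <;> rfl
      simp only [F, mem_ofPred_eq, mem_preimage, e₁, e₂]
    -- The dividing set for `c₁` is `D'(x₁, y) ∧ ¬∃ f, F(x₁, f)`. If `x₁` satisfied `N` of its
    -- instances along a sequence witnessing the dividing of `E`, those `N` parameters would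
    -- themselves form a forbidden `f`.
    refine typeDivides_of_definable hAB (E := D' ∩ (fun g : ξ₁ ⊕ Fin m → M => g ∘ Sum.inl) ⁻¹'
      {x₁ : ξ₁ → M | ∃ f : Fin N × Fin m → M, Sum.elim x₁ f ∈ F}ᶜ)
      (hD'.inter (hF.exists_of_finite.compl.preimage_comp Sum.inl)) hb (k := N) ⟨hbD, ?_⟩ ?_
    · rintro ⟨f, hf⟩
      obtain ⟨h₁, h₂⟩ := (hFmem c₁ (fun t i => f (t, i))).1 hf
      exact hN _ h₁ h₂
    · intro D₀ hD₀ hbD₀ N'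
      obtain ⟨f, hf, hk⟩ := hdiv D₀ hD₀ hbD₀ N'
      refine ⟨f, hf, fun s hs => ?_⟩
      rintro ⟨x₁, hx₁⟩
      let g : Fin N ↪ Fin N' := (s.orderEmbOfFin hs).toEmbedding
      have hg : ∀ t, g t ∈ s := fun t => s.orderEmbOfFin_mem hs t
      obtain ⟨t₀, ht₀⟩ | hs₀ := s.eq_empty_or_nonempty.symm
      · exact (hx₁ t₀ ht₀).2 ⟨_, (hFmem x₁ (fun t => f (g t))).2
          ⟨fun t => (hx₁ (g t) (hg t)).1, (hk.comp g).preimage (Sum.elim x₁)⟩⟩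
      -- For `N = 0` no instance is at hand to refute. Here failure for the empty sequence forces `k
      -- = 0`, but nothing is `0`-inconsistent.
      · have hN₀ : N = 0 := by rw [← hs, hs₀, Finset.card_empty]
        subst hN₀
        refine hN (fun t => t.elim0) (fun t => t.elim0) fun s' hs' => ?_
        have h0 : k = 0 := by rw [← hs', Finset.eq_empty_of_isEmpty s', Finset.card_empty]
        exact absurd ⟨Sum.elim c₁ c₂, by simp⟩ (hk ∅ (by rw [h0, Finset.card_empty]))

/-- A sequence of sets `A i ⊆ B i` such that the type of `c` over `B i` divides over `A i` for
all `i ∈ S`. -/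
structure IsDividingChain (L : FirstOrder.Language.{u, v}) {M : Type z} [L.Structure M]
    {I : Type w} [LinearOrder I] (S : Set I) (A B : I → Set M) {ξ : Type} (c : ξ → M) : Prop where
  subset : ∀ i, A i ⊆ B i
  subset_of_lt : ∀ i j, i < j → B i ⊆ A j
  typeDivides : ∀ i ∈ S, TypeDivides L c (B i) (A i)

theorem TypeDivides.comp_equiv {ξ ξ' : Type} {c : ξ → M} {B A : Set M} (e : ξ' ≃ ξ)
    (h : TypeDivides L c B A) : TypeDivides L (c ∘ e) B A := by
  obtain ⟨m, φ, b, k, hb, hφ, hdiv⟩ := h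
  have key : ∀ (x : ξ' → M) (y : Fin m → M),
      (φ.relabel (Sum.map e.symm id)).Realize (Sum.elim x y) ↔
        φ.Realize (Sum.elim (x ∘ e.symm) y) := by
    intro x y
    rw [Language.Formula.realize_relabel]
    apply iff_of_eq
    congr 1
    funext i
    rcases i with i | i <;> rfl
  refine ⟨m, φ.relabel (Sum.map e.symm id), b, k, hb, ?_, fun D hD hbD N => ?_⟩
  · rw [key]
    convert hφ using 2
    funext i
    simp
  · obtain ⟨f, hf, hk⟩ := hdiv D hD hbD N
    refine ⟨f, hf, fun s hs => ?_⟩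
    rintro ⟨x, hx⟩
    exact hk s hs ⟨x ∘ e.symm, fun t ht => (key _ _).1 (hx t ht)⟩

/-- The levels of a dividing chain for an `n + 1`-tuple can be coloured with `n + 1` colours such that each
colour class carries a dividing chain for a single element. -/
theorem IsDividingChain.exists_coloring {I : Type w} [LinearOrder I] (n : ℕ) :
    ∀ {S : Set I} {A B : I → Set M} {c : Fin (n + 1) → M}, IsDividingChain L S A B c →
      ∃ color : I → ℕ, (∀ i ∈ S, color i < n + 1) ∧ ∀ t < n + 1, ∃ (A' B' : I → Set M) (d : Fin 1 → M),
        IsDividingChain L {i ∈ S | color i = t} A' B' d := by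
  induction n with
  | zero =>
    intro S A B c h
    refine ⟨fun _ => 0, fun _ _ => Nat.zero_lt_one, fun t ht => ⟨A, B, c, h.subset, h.subset_of_lt,
      fun i hi => h.typeDivides i hi.1⟩⟩
  | succ n ih =>
    intro S A B c h
    classical
    let c₁ : Fin 1 → M := fun _ => c 0
    let c₂ : Fin (n + 1) → M := fun i => c i.succ
    let e : Fin 1 ⊕ Fin (n + 1) ≃ Fin (n + 1 + 1) := finSumFinEquiv.trans (finCongr (add_comm 1 (n + 1)))
    have hce : c ∘ e = Sum.elim c₁ c₂ := by
      funext i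
      rcases i with i | i
      · simp only [Function.comp_apply, Sum.elim_inl, c₁]
        congr 1
        ext
        simp [e]
      · simp only [Function.comp_apply, Sum.elim_inr, c₂]
        congr 1
        ext
        simp [e]
    have hsplit : ∀ i ∈ S, TypeDivides L c₁ (B i) (A i) ∨
        TypeDivides L c₂ (B i ∪ range c₁) (A i ∪ range c₁) := by
      intro i hi
      have := (h.typeDivides i hi).comp_equiv e
      rw [hce] at this
      exact this.fst_or_snd (h.subset i)
    -- Levels where `c₁` divides get the new colour `n + 1`; on the others, adjoining `c₁` to all
    -- sets leaves a chain for the remaining coordinates.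
    have h₂ : IsDividingChain L {i ∈ S | ¬ TypeDivides L c₁ (B i) (A i)}
        (fun i => A i ∪ range c₁) (fun i => B i ∪ range c₁) c₂ :=
      ⟨fun i => union_subset_union_left _ (h.subset i),
        fun i j hij => union_subset_union_left _ (h.subset_of_lt i j hij),
        fun i hi => (hsplit i hi.1).resolve_left hi.2⟩
    obtain ⟨color, hcol, hch⟩ := ih h₂
    refine ⟨fun i => if TypeDivides L c₁ (B i) (A i) then n + 1 else color i, fun i hi => ?_,
      fun t ht => ?_⟩
    · dsimp only
      split_ifs with h1
      · exact Nat.lt_succ_self (n + 1)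
      · exact (hcol i ⟨hi, h1⟩).trans (Nat.lt_succ_self (n + 1))
    · rcases Nat.lt_succ_iff_lt_or_eq.1 ht with ht | rfl
      · obtain ⟨A', B', d, hd⟩ := hch t ht
        refine ⟨A', B', d, hd.subset, hd.subset_of_lt, fun i hi => hd.typeDivides i ?_⟩
        have hit := hi.2
        dsimp only at hit
        split_ifs at hit with h1
        · exact absurd hit.symm ht.ne
        · exact ⟨⟨hi.1, h1⟩, hit⟩
      · refine ⟨A, B, c₁, h.subset, h.subset_of_lt, fun i hi => ?_⟩
        by_contra h1
        have hit := hi.2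
        dsimp only at hit
        rw [if_neg h1] at hit
        exact (hcol i ⟨hi.1, h1⟩).ne hit

end Dividing

/-! ### Choosing a generic branch. -/

open Filter

/-- Given finitely many properties of branches, each depending only on an initial segment with last
level `e d`, there is a branch such that each of the properties that it has is shared by infinitely
many of its modifications at level `e d`. -/
theorem exists_branch_infinite_of_finset {O δ : Type*} [LinearOrder O] [WellFoundedLT O]
    (Δ : Finset δ) (e : δ → O) (P : δ → (O → ℕ) → Prop)
    (hP : ∀ d ζ ζ', (∀ x ≤ e d, ζ x = ζ' x) → P d ζ → P d ζ') :
    ∃ η : O → ℕ, ∀ d ∈ Δ, P d η → {α : ℕ | P d (Function.update η (e d) α)}.Infinite := by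
  classical
  have hstep : ∀ (j : O) (ζ : O → ℕ), ∃ α : ℕ, ∀ d ∈ Δ, e d = j →
      P d (Function.update ζ j α) → {β : ℕ | P d (Function.update ζ j β)}.Infinite := by
    intro j ζ
    -- A label outside the finitely many finite sets satisfies only properties shared by infinitely
    -- many labels.
    have hfin : (⋃ d ∈ {d ∈ Δ | {β : ℕ | P d (Function.update ζ j β)}.Finite},
        {β : ℕ | P d (Function.update ζ j β)}).Finite :=
      Set.Finite.biUnion (Finset.finite_toSet {d ∈ Δ | _}) fun d hd => (Finset.mem_filter.1 hd).2
    obtain ⟨α, hα⟩ := hfin.infinite_compl.nonempty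
    refine ⟨α, fun d hd _ hPd hf => hα ?_⟩
    exact mem_iUnion₂.2 ⟨d, Finset.mem_filter.2 ⟨hd, hf⟩, hPd⟩
  choose G hG using hstep
  let η : O → ℕ := (wellFounded_lt (α := O)).fix fun j ih =>
    G j (fun x => if h : x < j then ih x h else 0)
  have hη : ∀ j, η j = G j (fun x => if x < j then η x else 0) := by
    intro j
    exact (wellFounded_lt (α := O)).fix_eq _ j
  refine ⟨η, fun d hd hPd => ?_⟩
  have hagree : ∀ α, ∀ x ≤ e d, Function.update η (e d) α x =
      Function.update (fun x => if x < e d then η x else 0) (e d) α x := by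
    intro α x hx
    rcases hx.lt_or_eq with hx | rfl
    · simp [hx.ne, hx]
    · simp
  have h := hG (e d) (fun x => if x < e d then η x else 0) d hd rfl
  rw [← hη] at h
  refine (h (hP d _ _ (hagree _) ?_)).mono fun α hα => hP d _ _ (fun x hx => (hagree α x hx).symm) hα
  rwa [Function.update_eq_self]

/-! ### Łoś's theorem for instances of formulas. -/

section Ultraproduct

variable {L : FirstOrder.Language.{u, v}} {M : Type z} [L.Structure M] [Nonempty M]
  {J : Type w} {U : Ultrafilter J}

theorem realize_ultrapower_sumElim {α β : Type*} (φ : L.Formula (α ⊕ β)) (x : α → J → M)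
    (y : β → J → M) :
    φ.Realize (M := (U : Filter J).Product fun _ => M)
      (Sum.elim (fun i => (x i : (U : Filter J).Product fun _ => M))
        (fun i => (y i : (U : Filter J).Product fun _ => M))) ↔
      ∀ᶠ j in U, φ.Realize (Sum.elim (fun i => x i j) (fun i => y i j)) := by
  have h₁ : (Sum.elim (fun i => (x i : (U : Filter J).Product fun _ => M))
      (fun i => (y i : (U : Filter J).Product fun _ => M))) =
      fun i => ((Sum.elim x y i : J → M) : (U : Filter J).Product fun _ => M) := by
    funext i
    rcases i with i | i <;> rfl
  have h₂ : ∀ j, (Sum.elim (fun i => x i j) (fun i => y i j)) = fun i => Sum.elim x y i j := by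
    intro j
    funext i
    rcases i with i | i <;> rfl
  simp only [h₂]
  refine (iff_of_eq (congrArg (Language.Formula.Realize
    (M := (U : Filter J).Product fun _ => M) φ) h₁)).trans ?_
  exact Language.Ultraproduct.realize_formula_cast (M := fun _ : J => M) (u := U) φ (Sum.elim x y)

/-- A family of definable sets that is `k`-inconsistent at almost all coordinates is
`k`-inconsistent in the ultrapower. -/
theorem kInconsistent_ultrapower {ξ : Type} {β : Type*} {ι : Type*} {k : ℕ}
    (φ : L.Formula (ξ ⊕ β)) (f : ι → β → J → M)
    (h : ∀ s : Finset ι, s.card = k → ∀ᶠ j in U, ¬ ∃ x : ξ → M, ∀ t ∈ s,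
      φ.Realize (Sum.elim x (fun i => f t i j))) :
    KInconsistent k (fun t => {x : ξ → (U : Filter J).Product fun _ => M |
      φ.Realize (Sum.elim x (fun i => (f t i : (U : Filter J).Product fun _ => M)))}) := by
  intro s hs
  rintro ⟨x, hx⟩
  choose y hy using fun i => Quotient.exists_rep (x i)
  obtain rfl : (fun i => (y i : (U : Filter J).Product fun _ => M)) = x := funext hy
  have h₂ : ∀ᶠ j in U, ∀ t ∈ s,
      φ.Realize (Sum.elim (fun i => y i j) (fun i => f t i j)) :=
    (Filter.eventually_all_finset s).2 fun t ht =>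
      (realize_ultrapower_sumElim φ y (f t)).1 (hx t ht)
  obtain ⟨j, hj₁, hj₂⟩ := ((h s hs).and h₂).exists
  exact hj₁ ⟨_, hj₂⟩

end Ultraproduct

/-! ### From cdt-patterns to dividing chains. -/

theorem snoc_restrict {j : Ordinal.{w}} (η : Ordinal.{w} → ℕ) (α : ℕ) :
    snoc (fun x : Iio j => η x) α = fun x : Iio (Order.succ j) => Function.update η j α x := by
  funext x
  by_cases h : x.1 < j
  · simp [snoc, h, h.ne]
  · have : x.1 = j := le_antisymm (Order.lt_succ_iff.1 x.2) (not_lt.1 h)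
    simp [snoc, this]

/-- A cdt-pattern gives a dividing chain in an ultrapower. -/
theorem exists_isDividingChain {L : FirstOrder.Language.{u, v}} {M : Type (max u v)} [L.Structure M]
    [Nonempty M] {n : ℕ} {κ : Cardinal.{w}} (P : CdtPattern L M n κ) {I : Type (max u v)}
    [LinearOrder I] (e : I → Ordinal.{w}) (he : StrictMono e)
    (hlt : ∀ i, Order.succ (e i) < κ.ord) :
    ∃ (J : Type (max u v)) (U : Ultrafilter J)
      (A B : I → Set ((U : Filter J).Product fun _ => M))
      (c : Fin n → (U : Filter J).Product fun _ => M), IsDividingChain L univ A B c := by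
  classical
  let m : I → ℕ := fun i => P.arity (Order.succ (e i))
  let V : Type (max u v) := Σ l : I, Fin (m l)
  -- The formulas that may occur in the type of the `i`-th parameter tuple over all lower ones.
  let Ψ : Type (max u v) := Σ i : I, L.Formula ({x : V // x.1 < i} ⊕ Fin (m i))
  let b : (l : I) → (Ordinal.{w} → ℕ) → Fin (m l) → M :=
    fun l ζ => P.param (Order.succ (e l)) (fun x => ζ x.1)
  let φ : (i : I) → L.Formula (Fin n ⊕ Fin (m i)) := fun i => P.formula (Order.succ (e i))
  let Q : Ψ → (Ordinal.{w} → ℕ) → Prop := fun d ζ =>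
    d.2.Realize (Sum.elim (fun x => b x.1.1 ζ x.1.2) (b d.1 ζ))
  have hb : ∀ l ζ ζ', (∀ x ≤ e l, ζ x = ζ' x) → b l ζ = b l ζ' := by
    intro l ζ ζ' h
    simp only [b]
    congr 1
    funext x
    exact h x.1 (Order.lt_succ_iff.1 x.2)
  have hQ : ∀ d ζ ζ', (∀ x ≤ e d.1, ζ x = ζ' x) → Q d ζ → Q d ζ' := by
    intro d ζ ζ' h hd
    have h₁ : ∀ x : {x : V // x.1 < d.1}, b x.1.1 ζ = b x.1.1 ζ' := fun x =>
      hb _ _ _ fun y hy => h y (hy.trans (he x.2).le)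
    simpa only [Q, h₁, hb _ _ _ h] using hd
  -- A coordinate lists finitely many levels at which `c` must satisfy its formula and finitely many
  -- formulas for which the branch must be generic.
  let J : Type (max u v) := Finset I × Finset Ψ
  choose η hη using fun j : J => exists_branch_infinite_of_finset j.2 (fun d => e d.1) Q hQ
  have hc : ∀ j : J, ∃ x : Fin n → M, ∀ i ∈ j.1, (φ i).Realize (Sum.elim x (b i (η j))) := by
    intro j
    obtain ⟨x, hx⟩ := P.consistent (fun y => η j y.1)
      (j.1.image fun i => ⟨Order.succ (e i), hlt i, mem_range_self _⟩)
    exact ⟨x, fun i hi => hx _ (Finset.mem_image_of_mem _ hi)⟩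
  choose c hc using hc
  let U : Ultrafilter J := Ultrafilter.of atTop
  have hU : ∀ j₀ : J, ∀ᶠ j in U, j₀ ≤ j := fun j₀ =>
    Ultrafilter.of_le atTop (eventually_ge_atTop j₀)
  let b' : (x : V) → (U : Filter J).Product fun _ => M :=
    fun x => ((fun j => b x.1 (η j) x.2 : J → M) : (U : Filter J).Product fun _ => M)
  refine ⟨J, U, fun i => range fun x : {x : V // x.1 < i} => b' x.1,
    fun i => range fun x : {x : V // x.1 ≤ i} => b' x.1,
    fun t => ((fun j => c j t : J → M) : (U : Filter J).Product fun _ => M), ?_, ?_, ?_⟩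
  · rintro i _ ⟨x, rfl⟩
    exact ⟨⟨x.1, x.2.le⟩, rfl⟩
  · rintro i i' hi _ ⟨x, rfl⟩
    exact ⟨⟨x.1, x.2.trans_lt hi⟩, rfl⟩
  · intro i _
    refine ⟨m i, φ i, fun t => b' ⟨i, t⟩, P.bound (Order.succ (e i)), ?_, ?_, ?_⟩
    · rintro _ ⟨t, rfl⟩
      exact ⟨⟨⟨i, t⟩, le_rfl⟩, rfl⟩
    · refine (realize_ultrapower_sumElim (φ i) (fun t j => c j t)
        (fun t j => b i (η j) t)).2 ?_
      filter_upwards [hU ({i}, ∅)] with j hj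
      exact hc j i (hj.1 (Finset.mem_singleton_self i))
    · intro D hD hbD N
      obtain ⟨ψ, rfl⟩ := (definable_range_iff _).1 hD
      have hψ : ∀ᶠ j in U, Q ⟨i, ψ⟩ (η j) := (realize_ultrapower_sumElim ψ
        (fun (x : {x : V // x.1 < i}) j => b x.1.1 (η j) x.1.2) (fun t j => b i (η j) t)).1 hbD
      -- Genericity supplies `N` distinct siblings inside the given definable set; being siblings,
      -- they inherit the inconsistency of the pattern. Coordinates outside the ultrafilter set get
      -- an arbitrary embedding.
      have hex : ∀ j, ∃ g : Fin N ↪ ℕ, Q ⟨i, ψ⟩ (η j) → ⟨i, ψ⟩ ∈ j.2 →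
          ∀ t, Q ⟨i, ψ⟩ (Function.update (η j) (e i) (g t)) := by
        intro j
        by_cases hj : Q ⟨i, ψ⟩ (η j) ∧ ⟨i, ψ⟩ ∈ j.2
        · have hinf := hη j _ hj.2 hj.1
          have := hinf.to_subtype
          let g₀ : ℕ ↪ {α : ℕ | Q ⟨i, ψ⟩ (Function.update (η j) (e i) α)} :=
            Infinite.natEmbedding _
          exact ⟨Fin.valEmbedding.trans (g₀.trans (Function.Embedding.subtype _)),
            fun _ _ t => (g₀ t.1).2⟩
        · exact ⟨Fin.valEmbedding, fun h₁ h₂ => absurd ⟨h₁, h₂⟩ hj⟩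
      choose g hg using hex
      let f : Fin N → Fin (m i) → J → M := fun t s j =>
        b i (Function.update (η j) (e i) (g j t)) s
      refine ⟨fun t s => (f t s : (U : Filter J).Product fun _ => M), fun t => ?_,
        kInconsistent_ultrapower (φ i) f fun s hs => Eventually.of_forall fun j => ?_⟩
      · refine (realize_ultrapower_sumElim ψ
          (fun (x : {x : V // x.1 < i}) j => b x.1.1 (η j) x.1.2) (f t)).2 ?_
        filter_upwards [hψ, hU (∅, {⟨i, ψ⟩})] with j hj₁ hj₂
        have h := hg j hj₁ (hj₂.2 (Finset.mem_singleton_self _)) t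
        have h₁ : ∀ x : {x : V // x.1 < i},
            b x.1.1 (Function.update (η j) (e i) (g j t)) = b x.1.1 (η j) := fun x =>
          hb _ _ _ fun y hy => Function.update_of_ne (hy.trans_lt (he x.2)).ne _ _
        simpa only [Q, h₁] using h
      · have h := (P.inconsistent (e i) (hlt i) (fun x => η j x.1)).comp (g j) s hs
        simpa only [snoc_restrict, solutions, mem_ofPred_eq] using h

/-! ### From dividing chains to cdt-patterns, via finite trees. -/

section FiniteTree

variable {L : FirstOrder.Language.{u, v}} {M : Type z} [L.Structure M] {I : Type w}
  {n : ℕ} {m : I → ℕ}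

/-- There is a tree of parameters with branching `N + 1` and levels `ls` in which the siblings at
level `l` are `k l`-inconsistent, and such that all branches are consistent with `W`. -/
def HasFiniteTree (φ : ∀ l, L.Formula (Fin n ⊕ Fin (m l))) (k : I → ℕ) (N : ℕ) :
    List I → Set (Fin n → M) → Prop
  | [], W => W.Nonempty
  | l :: ls, W => ∃ f : Fin (N + 1) → Fin (m l) → M,
      KInconsistent (k l) (fun α => solutions (φ l) (f α)) ∧
        ∀ α, HasFiniteTree φ k N ls (W ∩ solutions (φ l) (f α))

/-- Finite branching and finitely many levels make the existence of the tree first-order. The extra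
variables `ρ` absorb the parameters chosen at lower levels. -/
theorem definable_hasFiniteTree {A : Set M} (φ : ∀ l, L.Formula (Fin n ⊕ Fin (m l))) (k : I → ℕ)
    (N : ℕ) (ls : List I) :
    ∀ {ρ : Type} {W : Set (ρ ⊕ Fin n → M)}, A.Definable L W →
      A.Definable L {v : ρ → M | HasFiniteTree φ k N ls {x | Sum.elim v x ∈ W}} := by
  induction ls with
  | nil =>
    intro ρ W hW
    simpa only [HasFiniteTree, Set.Nonempty, mem_ofPred_eq] using hW.exists_of_finite
  | cons l ls ih =>
    intro ρ W hW
    let r : Fin (N + 1) → Fin n ⊕ Fin (m l) → (ρ ⊕ Fin (N + 1) × Fin (m l)) ⊕ Fin n := fun α =>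
      Sum.elim Sum.inr (fun s => Sum.inl (Sum.inr (α, s)))
    let G : Fin (N + 1) → Set ((ρ ⊕ Fin (N + 1) × Fin (m l)) ⊕ Fin n → M) := fun α =>
      (fun g => g ∘ r α) ⁻¹' {v | (φ l).Realize v}
    have hG : ∀ α, A.Definable L (G α) := fun α =>
      ((empty_definable_iff.2 ⟨φ l, rfl⟩).mono (empty_subset A)).preimage_comp (r α)
    let W' : Set ((ρ ⊕ Fin (N + 1) × Fin (m l)) ⊕ Fin n → M) :=
      (fun g => g ∘ Sum.map Sum.inl id) ⁻¹' W
    have hW' : A.Definable L W' := hW.preimage_comp _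
    have h := ((definable_kInconsistent (k l) hG).inter (definable_iInter_of_finite fun α =>
      ih (hW'.inter (hG α)))).exists_of_finite
    have hr : ∀ (v : ρ → M) (f : Fin (N + 1) × Fin (m l) → M) (x : Fin n → M) α,
        Sum.elim (Sum.elim v f) x ∘ r α = Sum.elim x (fun s => f (α, s)) := by
      intro v f x α
      funext i
      rcases i with i | i <;> rfl
    have hmap : ∀ (v : ρ → M) (f : Fin (N + 1) × Fin (m l) → M) (x : Fin n → M),
        Sum.elim (Sum.elim v f) x ∘ Sum.map Sum.inl id = Sum.elim v x := by
      intro v f x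
      funext i
      rcases i with i | i <;> rfl
    convert h using 1
    ext v
    simp only [mem_inter_iff, mem_iInter, mem_ofPred_eq, G, W', mem_preimage, hr, hmap]
    constructor
    · rintro ⟨f, hf, ht⟩
      exact ⟨fun i => f i.1 i.2, hf, ht⟩
    · rintro ⟨f, hf, ht⟩
      exact ⟨fun α s => f (α, s), hf, ht⟩

/-- By induction, the set of `y` that can replace `b l` and still carry a tree on the later levels
contains `b l`. It is definable over `A l`, so dividing finds `N + 1` inconsistent siblings in it.
-/
theorem hasFiniteTree_of_divides [LinearOrder I] {A : I → Set M} {c : Fin n → M}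
    {φ : ∀ l, L.Formula (Fin n ⊕ Fin (m l))} {b : ∀ l, Fin (m l) → M} {k : I → ℕ}
    (hA : ∀ i j, i < j → A i ⊆ A j) (hb : ∀ i j, i < j → range (b i) ⊆ A j)
    (hφ : ∀ i, (φ i).Realize (Sum.elim c (b i)))
    (hdiv : ∀ i, Divides L (A i) {v | (φ i).Realize v} (b i) (k i)) (N : ℕ) (ls : List I) :
    ls.Pairwise (· < ·) → ∀ W : Set (Fin n → M), c ∈ W → (∀ l ∈ ls, (A l).Definable L W) →
      HasFiniteTree φ k N ls W := by
  induction ls with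
  | nil => exact fun _ W hc _ => ⟨c, hc⟩
  | cons l ls ih =>
    intro hs W hc hW
    obtain ⟨hl, hs⟩ := List.pairwise_cons.1 hs
    have hWl := hW l List.mem_cons_self
    have hφdef : ∀ B : Set M, B.Definable L {v | (φ l).Realize v} := fun B =>
      (empty_definable_iff.2 ⟨φ l, rfl⟩).mono (empty_subset B)
    have hswap : ∀ (x : Fin n → M) (y : Fin (m l) → M), Sum.elim y x ∘ Sum.swap = Sum.elim x y := by
      intro x y
      funext i
      rcases i with i | i <;> rfl
    have hD := definable_hasFiniteTree φ k N ls (ρ := Fin (m l))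
      ((hWl.preimage_comp (Sum.inr : Fin n → Fin (m l) ⊕ Fin n)).inter
        ((hφdef (A l)).preimage_comp (Sum.swap : Fin n ⊕ Fin (m l) → Fin (m l) ⊕ Fin n)))
    obtain ⟨f, hf, hk⟩ := hdiv l _ hD (by
      refine ih hs _ ⟨hc, ?_⟩ fun l' hl' => ?_
      · simpa only [mem_preimage, mem_ofPred_eq, hswap] using hφ l
      · refine definable_fiber (b l) (hb l l' (hl l' hl')) ?_
        exact ((hWl.mono (hA l l' (hl l' hl'))).preimage_comp _).inter
          ((hφdef (A l')).preimage_comp _)) (N + 1)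
    refine ⟨f, hk, fun α => ?_⟩
    have := hf α
    simp only [mem_ofPred_eq, mem_inter_iff, mem_preimage, hswap, Sum.elim_comp_inr] at this
    exact this

/-- Unfolds the nested existential into a single tree function; `b` only fills in levels outside the
list. -/
theorem HasFiniteTree.exists_param [LinearOrder I] {φ : ∀ l, L.Formula (Fin n ⊕ Fin (m l))}
    {k : I → ℕ} {N : ℕ} (b : ∀ l, Fin (m l) → M) (ls : List I) :
    ls.Pairwise (· < ·) → ∀ W : Set (Fin n → M), HasFiniteTree φ k N ls W →
      ∃ a : (I → Fin (N + 1)) → ∀ l, Fin (m l) → M,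
        (∀ l ∈ ls, ∀ ζ ζ', (∀ x ≤ l, ζ x = ζ' x) → a ζ l = a ζ' l) ∧
        (∀ l ∈ ls, ∀ ζ, KInconsistent (k l)
          (fun α => solutions (φ l) (a (Function.update ζ l α) l))) ∧
        ∀ ζ, ∃ x ∈ W, ∀ l ∈ ls, x ∈ solutions (φ l) (a ζ l) := by
  induction ls with
  | nil =>
    rintro - W ⟨x, hx⟩
    exact ⟨fun _ => b, by simp, by simp, fun _ => ⟨x, hx, by simp⟩⟩
  | cons l ls ih =>
    rintro hs W ⟨f, hf, ht⟩
    obtain ⟨hl, hs⟩ := List.pairwise_cons.1 hs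
    choose a ha₁ ha₂ ha₃ using fun α => ih hs _ (ht α)
    refine ⟨fun ζ => Function.update (a (ζ l) ζ) l (f (ζ l)), ?_, ?_, ?_⟩
    · intro l' hl' ζ ζ' h
      rcases List.mem_cons.1 hl' with rfl | hl'
      · simp [h l' le_rfl]
      · have hlt := hl l' hl'
        simp only [Function.update_of_ne hlt.ne', h l hlt.le]
        exact ha₁ _ l' hl' _ _ h
    · intro l' hl' ζ
      rcases List.mem_cons.1 hl' with rfl | hl'
      · simpa using hf
      · have hlt := hl l' hl'
        simp only [Function.update_of_ne hlt.ne', Function.update_of_ne hlt.ne]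
        exact ha₂ _ l' hl' ζ
    · intro ζ
      obtain ⟨x, hx, hx'⟩ := ha₃ (ζ l) ζ
      refine ⟨x, hx.1, fun l' hl' => ?_⟩
      rcases List.mem_cons.1 hl' with rfl | hl'
      · simpa using hx.2
      · have hlt := hl l' hl'
        simp only [Function.update_of_ne hlt.ne']
        exact hx' l' hl'

end FiniteTree

/-- A dividing chain gives a cdt-pattern in an ultrapower. -/
theorem IsDividingChain.exists_cdtPattern {L : FirstOrder.Language.{u, v}} {M : Type (max u v)}
    [L.Structure M] [Nonempty M] {n : ℕ} {κ : Cardinal.{w}} {I : Type (max u v)} [LinearOrder I]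
    {A B : I → Set M} {c : Fin n → M} (h : IsDividingChain L univ A B c) (e : I → Ordinal.{w})
    (he : StrictMono e) (G : Ordinal.{w} → I) (hG : ∀ j, Order.succ j < κ.ord →
      e (G (Order.succ j)) = j) :
    ∃ (J : Type (max u v)) (U : Ultrafilter J),
      Nonempty (CdtPattern L ((U : Filter J).Product fun _ => M) n κ) := by
  classical
  choose m φ b k hb hφ hdiv using fun i => h.typeDivides i (mem_univ i)
  have hfin : ∀ j : Finset I × ℕ, ∃ a : (I → ℕ) → ∀ l, Fin (m l) → M,
      (∀ l, ∀ ζ ζ', (∀ x ≤ l, ζ x = ζ' x) → a ζ l = a ζ' l) ∧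
      (∀ l ∈ j.1, ∀ ζ, KInconsistent (k l)
        (fun α : Fin (j.2 + 1) => solutions (φ l) (a (Function.update ζ l α) l))) ∧
      ∀ ζ, ∃ x : Fin n → M, ∀ l ∈ j.1, x ∈ solutions (φ l) (a ζ l) := by
    rintro ⟨F, N⟩
    have ht := hasFiniteTree_of_divides (fun i j hij => (h.subset i).trans (h.subset_of_lt i j hij))
      (fun i j hij => (hb i).trans (h.subset_of_lt i j hij)) hφ hdiv N F.sort F.sortedLT_sort.pairwise
      univ (mem_univ c) (fun _ _ => definable_univ)
    obtain ⟨a, ha₁, ha₂, ha₃⟩ := HasFiniteTree.exists_param b _ F.sortedLT_sort.pairwise _ ht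
    simp only [Finset.mem_sort] at ha₁ ha₂ ha₃
    -- Labels are read modulo `N + 1`, and those above `l` are erased so that level `l` depends only
    -- on earlier labels even when `l ∉ F`.
    let tr : I → (I → ℕ) → I → Fin (N + 1) := fun l ζ x =>
      if x ≤ l then Fin.ofNat (N + 1) (ζ x) else 0
    have htr : ∀ l ∈ F, ∀ ζ, a (tr l ζ) l = a (fun x => Fin.ofNat (N + 1) (ζ x)) l := by
      intro l hl ζ
      exact ha₁ l hl _ _ fun x hx => if_pos hx
    refine ⟨fun ζ l => a (tr l ζ) l, fun l ζ ζ' hζ => ?_, fun l hl ζ => ?_, fun ζ => ?_⟩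
    · have : tr l ζ = tr l ζ' := by
        funext x
        by_cases hx : x ≤ l
        · simp only [tr, if_pos hx, hζ x hx]
        · simp only [tr, if_neg hx]
      simp only [this]
    · convert ha₂ l hl (fun x => Fin.ofNat (N + 1) (ζ x)) using 3 with α
      refine (htr l hl _).trans ?_
      congr 1
      funext x
      by_cases hx : x = l
      · subst hx
        simp
      · simp [hx]
    · obtain ⟨x, -, hx⟩ := ha₃ fun x => Fin.ofNat (N + 1) (ζ x)
      refine ⟨x, fun l hl => ?_⟩
      dsimp only
      rw [htr l hl]
      exact hx l hl
  choose a ha₁ ha₂ ha₃ using hfin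
  let J : Type (max u v) := Finset I × ℕ
  let U : Ultrafilter J := Ultrafilter.of atTop
  have hU : ∀ j₀ : J, ∀ᶠ j in U, j₀ ≤ j := fun j₀ =>
    Ultrafilter.of_le atTop (eventually_ge_atTop j₀)
  let a' : (I → ℕ) → ∀ l, Fin (m l) → (U : Filter J).Product fun _ => M := fun ζ l t =>
    ((fun j => a j ζ l t : J → M) : (U : Filter J).Product fun _ => M)
  -- Level `l` reads the label at the ordinal `e l`, so the tuple at height `j + 1` sits at level `G
  -- (j + 1)`, whose own label is the last one, at `j`.
  let ext : {o : Ordinal.{w}} → (Iio o → ℕ) → I → ℕ := fun {o} η l =>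
    if hl : e l < o then η ⟨e l, hl⟩ else 0
  refine ⟨J, U, ⟨⟨fun i => m (G i), fun i => φ (G i), fun i => k (G i),
    fun i η => a' (ext η) (G i), fun η s => ?_, fun j hj η => ?_⟩⟩⟩
  · choose x hx using fun j => ha₃ j (ext η)
    refine ⟨fun t => ((fun j => x j t : J → M) : (U : Filter J).Product fun _ => M),
      fun i hi => ?_⟩
    obtain ⟨_, hlt, o, rfl⟩ := i
    refine (realize_ultrapower_sumElim (φ _) (fun t j => x j t) (fun t j => a j _ _ t)).2 ?_
    filter_upwards [hU ({G (Order.succ o)}, 0)] with j hj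
    have h₁ := hx j _ (hj.1 (Finset.mem_singleton_self _))
    rw [ha₁ j _ (ext η) (ext (nodeBelow η hlt.le))] at h₁
    · exact h₁
    · intro l hl
      have hl' : e l < Order.succ o := by
        rw [Order.lt_succ_iff, ← hG o hlt]
        exact he.monotone hl
      simp only [ext, dif_pos hl', dif_pos (hl'.trans hlt), nodeBelow]
  · refine kInconsistent_ultrapower (φ _) (fun α t j => a j (ext (snoc η α)) _ t) fun s hs => ?_
    have hext : ∀ α, ext (snoc η α) = Function.update (ext η) (G (Order.succ j)) α := by
      intro α
      funext l
      by_cases hl : l = G (Order.succ j)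
      · subst hl
        have hGj : e (G (j + 1)) = j := by simpa using hG j hj
        simp [ext, hGj, snoc]
      · have hne : e l ≠ j := fun hel => hl (he.injective (hel.trans (hG j hj).symm))
        rw [Function.update_of_ne hl]
        by_cases hlt : e l < j
        · simp [ext, snoc, hlt, hlt.le]
        · have : ¬ e l ≤ j := fun hle => hlt (lt_of_le_of_ne hle hne)
          simp [ext, hlt, this]
    -- Once the branching exceeds every label in `s`, reduction modulo `p.2 + 1` does not identify
    -- siblings.
    filter_upwards [hU ({G (Order.succ j)}, s.sup id)] with p hp
    have hsp : ∀ t ∈ s, t < p.2 + 1 := fun t ht =>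
      Nat.lt_succ_of_le ((Finset.le_sup (f := id) ht).trans hp.2)
    rintro ⟨x, hx⟩
    refine ha₂ p _ (hp.1 (Finset.mem_singleton_self _)) (ext η) (s.attachFin hsp)
      (by rw [Finset.card_attachFin, hs]) ⟨x, fun α hα => ?_⟩
    have := hx α.1 (Finset.mem_attachFin hsp |>.1 hα)
    rw [hext] at this
    exact this

/-! ### Reduction to one variable. -/

theorem IsDividingChain.comp {L : FirstOrder.Language.{u, v}} {M : Type z} [L.Structure M]
    {I : Type*} {I' : Type*} [LinearOrder I] [LinearOrder I'] {S : Set I} {A B : I → Set M}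
    {ξ : Type} {c : ξ → M} (h : IsDividingChain L S A B c) {f : I' → I} (hf : StrictMono f)
    (hS : ∀ x, f x ∈ S) : IsDividingChain L univ (A ∘ f) (B ∘ f) c :=
  ⟨fun i => h.subset (f i), fun _ _ hij => h.subset_of_lt _ _ (hf hij),
    fun i _ => h.typeDivides _ (hS i)⟩

variable {L : FirstOrder.Language.{u, v}} {T : L.Theory}

theorem ultrapower_models {M : Type (max u v)} [L.Structure M] [M ⊨ T] [Nonempty M]
    {J : Type (max u v)} (U : Ultrafilter J) : ((U : Filter J).Product fun _ => M) ⊨ T :=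
  ⟨fun φ hφ => (Language.Ultraproduct.sentence_realize φ).2
    (Eventually.of_forall fun _ => Language.Theory.realize_sentence_of_mem T hφ)⟩

/-- `hcol` isolates the pigeonhole principle, which differs for finite and infinite depths. A colour
class is well-ordered, so one of size at least `κ'` contains a copy of `κ'.ord`. -/
theorem _root_.HasCdtPattern.reduce_to_one {n : ℕ} {κ κ' : Cardinal.{max u v}}
    (h : HasCdtPattern T (n + 1) κ) (hκ' : κ' ≠ 0) {I : Type (max u v)} [LinearOrder I]
    [WellFoundedLT I] (e : I → Ordinal.{max u v}) (he : StrictMono e)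
    (hlt : ∀ i, Order.succ (e i) < κ.ord)
    (hcol : ∀ color : I → ℕ, (∀ i, color i < n + 1) → ∃ t < n + 1, κ' ≤ #{i | color i = t}) :
    HasCdtPattern T 1 κ' := by
  obtain ⟨M, ⟨P⟩⟩ := h
  obtain ⟨J, U, A, B, c, hchain⟩ := exists_isDividingChain P e he hlt
  obtain ⟨color, hc, hch⟩ := hchain.exists_coloring
  obtain ⟨t, ht, hcard⟩ := hcol color fun i => hc i (mem_univ i)
  obtain ⟨A', B', d, hd⟩ := hch t ht
  have htype : Ordinal.type (α := κ'.ord.ToType) (· < ·) ≤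
      Ordinal.type (α := {i | color i = t}) (· < ·) := by
    rw [Ordinal.type_toType]
    exact (Cardinal.ord_le_ord.2 hcard).trans (Cardinal.ord_le_type _)
  obtain ⟨g⟩ := Ordinal.type_le_iff.1 htype
  have hchain' := hd.comp (f := fun x => (g x).1) (fun x y hxy => g.map_rel_iff.2 hxy)
    fun x => ⟨mem_univ _, (g x).2⟩
  have h0 : (0 : Ordinal) < κ'.ord := by
    rw [Cardinal.lt_ord, Ordinal.card_zero]
    exact pos_iff_ne_zero.2 hκ'
  classical
  let G : Ordinal.{max u v} → κ'.ord.ToType := fun o =>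
    if ho : o.pred < κ'.ord then Ordinal.ToType.mk ⟨o.pred, ho⟩ else Ordinal.ToType.mk ⟨0, h0⟩
  obtain ⟨J', U', hP⟩ := hchain'.exists_cdtPattern (κ := κ')
    (fun x => (Ordinal.ToType.mk.symm x).1)
    (fun x y hxy => Ordinal.ToType.mk.symm.strictMono hxy) G (by
      intro j hj
      have hj' : j < κ'.ord := (Order.lt_succ j).trans hj
      simp [G, hj'])
  have := ultrapower_models (T := T) (M := M) U
  have := ultrapower_models (T := T) (M := (U : Filter J).Product fun _ => M) U'
  exact ⟨Language.Theory.ModelType.of T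
    ((U' : Filter J').Product fun _ => (U : Filter J).Product fun _ => M), hP⟩

/-- Singular `κ` is no obstacle: the number of colours is finite, hence below the cofinality. -/
theorem _root_.HasCdtPattern.one_of_aleph0_le {n : ℕ} {κ : Cardinal.{max u v}} (hκ : ℵ₀ ≤ κ)
    (h : HasCdtPattern T (n + 1) κ) : HasCdtPattern T 1 κ := by
  refine h.reduce_to_one (aleph0_pos.trans_le hκ).ne' (I := κ.ord.ToType)
    (fun x => (Ordinal.ToType.mk.symm x).1)
    (fun x y hxy => Ordinal.ToType.mk.symm.strictMono hxy)
    (fun x => (isSuccLimit_ord hκ).succ_lt (Ordinal.ToType.mk.symm x).2) fun color hcolor => ?_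
  obtain ⟨t, ht⟩ := infinite_pigeonhole_card
    (fun x => (ULift.up ⟨color x, hcolor x⟩ : ULift.{max u v} (Fin (n + 1)))) κ
    (mk_ord_toType κ).ge hκ
    ((lt_aleph0_of_finite _).trans_le
      (Ordinal.aleph0_le_cof_iff.2 (Ordinal.one_lt_cof_iff.2 (isSuccLimit_ord hκ))))
  refine ⟨t.down, t.down.2, ht.trans (mk_le_mk_of_subset fun x hx => ?_)⟩
  exact congrArg (fun s : ULift.{max u v} (Fin (n + 1)) => (s.down : ℕ)) hx

theorem _root_.HasCdtPattern.one_of_nat {n : ℕ} (h : ∀ N : ℕ, HasCdtPattern T (n + 1) N) (m : ℕ)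
    (hm : m ≠ 0) : HasCdtPattern T 1 m := by
  -- Only successors below the depth count, so the extra `1` leaves exactly `(n + 1) * m` levels.
  refine (h ((n + 1) * m + 1)).reduce_to_one (Nat.cast_ne_zero.2 hm)
    (I := ULift.{max u v} (Fin ((n + 1) * m))) (fun x => (x.down : ℕ))
    (fun x y hxy => Nat.cast_lt.2 hxy) (fun x => ?_) fun color hcolor => ?_
  · rw [Cardinal.ord_natCast, Order.succ_eq_add_one, ← Nat.cast_add_one, Nat.cast_lt]
    exact Nat.succ_lt_succ x.down.2
  · obtain ⟨t, ht⟩ := Fintype.exists_le_card_fiber_of_mul_le_card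
      (fun x => (⟨color x, hcolor x⟩ : Fin (n + 1))) (n := m) (by simp)
    refine ⟨t, t.2, ?_⟩
    rw [← Fintype.card_subtype] at ht
    rw [Cardinal.mk_fintype, Nat.cast_le]
    refine ht.trans (Fintype.card_le_of_injective
      (fun x => ⟨x.1, congrArg Fin.val x.2⟩) fun x y hxy => ?_)
    exact Subtype.ext (congrArg (fun z : {i | color i = (t : ℕ)} => z.1) hxy)

theorem _root_.HasCdtPattern.zero {n : ℕ} {κ : Cardinal.{max u v}} (h : HasCdtPattern T n κ)
    (n' : ℕ) : HasCdtPattern T n' (0 : Cardinal.{max u v}) := by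
  obtain ⟨M, -⟩ := h
  have h0 : ∀ i : Ordinal.{max u v}, ¬ i < (0 : Cardinal.{max u v}).ord := by simp
  exact ⟨M, ⟨⟨fun _ => 0, fun _ => ⊥, fun _ => 0, fun _ _ t => t.elim0,
    fun _ _ => ⟨fun _ => Classical.arbitrary M, fun i _ => absurd i.2.1 (h0 _)⟩,
    fun _ hj => absurd hj (h0 _)⟩⟩⟩

/-- Patterns in one variable are patterns in more variables, by adding dummy variables. -/
theorem _root_.HasCdtPattern.of_one {n : ℕ} {κ : Cardinal.{max u v}} (h : HasCdtPattern T 1 κ) :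
    HasCdtPattern T (n + 1) κ := by
  obtain ⟨M, ⟨P⟩⟩ := h
  have key : ∀ i (x : Fin (n + 1) → M) (y : Fin (P.arity i) → M),
      x ∈ solutions ((P.formula i).relabel (Sum.map (fun _ => 0) id)) y ↔
        (fun _ => x 0) ∈ solutions (P.formula i) y := by
    intro i x y
    simp only [solutions, mem_ofPred_eq, Language.Formula.realize_relabel]
    apply iff_of_eq
    congr 1
    funext s
    rcases s with s | s <;> rfl
  refine ⟨M, ⟨⟨P.arity, fun i => (P.formula i).relabel (Sum.map (fun _ => 0) id), P.bound, P.param,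
    fun η s => ?_, fun j hj η s hs => ?_⟩⟩⟩
  · obtain ⟨x, hx⟩ := P.consistent η s
    refine ⟨fun _ => x 0, fun i hi => (key _ _ _).2 ?_⟩
    convert hx i hi using 1
    funext t
    exact congrArg x (Subsingleton.elim _ _)
  · rintro ⟨x, hx⟩
    exact P.inconsistent j hj η s hs ⟨fun _ => x 0, fun i hi => (key _ _ _).1 (hx i hi)⟩

theorem kappaCdt_le {n : ℕ} {κ : Cardinal.{max u v}} (h : ¬ HasCdtPattern T n κ) :
    kappaCdt T n ≤ κ :=
  (WithTop.isGLB_sInf _).1 ⟨κ, h, rfl⟩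

theorem le_kappaCdt {n : ℕ} {a : WithTop Cardinal.{max u v}}
    (h : ∀ κ : Cardinal.{max u v}, ¬ HasCdtPattern T n κ → a ≤ κ) : a ≤ kappaCdt T n := by
  refine (WithTop.isGLB_sInf _).2 ?_
  rintro _ ⟨κ, hκ, rfl⟩
  exact h κ hκ

end CdtPattern

open CdtPattern in
theorem mainTheorem11 {L : FirstOrder.Language.{u, v}} (T : L.Theory) (n : ℕ) (hn : 1 ≤ n)
    (hinf : ((ℵ₀ : Cardinal.{max u v}) : WithTop Cardinal.{max u v}) ≤ kappaCdt T 1 ∨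
      ((ℵ₀ : Cardinal.{max u v}) : WithTop Cardinal.{max u v}) ≤ kappaCdt T n) :
    kappaCdt T 1 = kappaCdt T n := by
  obtain ⟨n, rfl⟩ := Nat.exists_eq_add_of_le' hn
  have hle : kappaCdt T 1 ≤ kappaCdt T (n + 1) :=
    le_kappaCdt fun κ hκ => kappaCdt_le fun h => hκ h.of_one
  have hinf' : ((ℵ₀ : Cardinal.{max u v}) : WithTop Cardinal.{max u v}) ≤ kappaCdt T (n + 1) :=
    hinf.elim (fun h => h.trans hle) id
  have hnat : ∀ N : ℕ, HasCdtPattern T (n + 1) N := by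
    intro N
    by_contra hN
    exact absurd (WithTop.coe_le_coe.1 (hinf'.trans (kappaCdt_le hN)))
      (not_le.2 (natCast_lt_aleph0 (n := N)))
  refine le_antisymm hle (le_kappaCdt fun κ hκ => ?_)
  -- A finite `κ` cannot lack a one-variable pattern, by `hnat`; an infinite one is handled at the
  -- same depth.
  rcases lt_or_ge κ ℵ₀ with hfin | hge
  · obtain ⟨m, rfl⟩ := lt_aleph0.1 hfin
    refine absurd ?_ hκ
    rcases eq_or_ne m 0 with rfl | hm
    · simpa using (hnat 0).zero 1
    · exact HasCdtPattern.one_of_nat hnat m hm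
  · exact kappaCdt_le fun h => hκ (h.one_of_aleph0_le hge)
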